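/- **Setting.** Fix a function-free first-order signature (without equality) with a set $\mathbf P$ of predicate symbols and an infinite set $\Delta$ of constants. A (Herbrand) interpretation is a set of ground atoms; $\mathcal I$ is the set of all interpretations. MKNF formulae are built from atoms by $\lnot,\land,\exists$ and the modal operators $\mathbf K$, $\mathbf{not}$; for an interpretation $I$ and $M,N\subseteq\mathcal I$, satisfaction in $(I,M,N)$ is as usual for ground atoms (truth in $I$), $\lnot$, $\land$, $\exists$ (over $c\in\Delta$), while $(I,M,N)\models\mathbf K\phi$ iff $(J,M,N)\models\phi$ for all $J\in M$, and $(I,M,N)\models\mathbf{not}\,\phi$ iff $(J,M,N)\not\models\phi$ for some $J\in N$. For a set $T$ of sentences, $M\models T$ means $(I,M,M)\models\phi$ for all $\phi\in T$, $I\in M$. An MKNF interpretation is a nonempty $M\subseteq\mathcal I$. For a first-order theory $T$ (a set of sentences without modal operators), $\mathsf{mod}(T)$ is the greatest $M\subseteq\mathcal I$ with $M\models T$. For any expression, $\mathsf{pr}(\cdot)$ is the set of predicate symbols occurring in it. **Minimal change update.** Put $J\le_I J'$ if for every $P\in\mathbf P$ the set of $P$-atoms on which $I$ and $J$ differ is contained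 in the set of $P$-atoms on which $I$ and $J'$ differ, and $J<_I J'$ if $J\le_I J'$ and not $J'\le_I J$. Let $I\oplus N=\{J\in N: \text{there is no } J'\in N \text{ with } J'<_I J\}$ and $M\oplus N=\bigcup_{I\in M}(I\oplus N)$. For theories $T_0,\dots,T_{n-1}$ let $\mathsf{mod}(\langle T_i\rangle_{i<n})=(\cdots((\mathcal I\oplus\mathsf{mod}(T_0))\oplus\mathsf{mod}(T_1))\cdots)\oplus\mathsf{mod}(T_{n-1})$ (so it is $\mathcal I$ for $n=0$, and $\mathcal I\oplus\mathsf{mod}(T_0)=\mathsf{mod}(T_0)$). If it is nonempty, it is called the *minimal change update model* of $\langle T_i\rangle_{i<n}$. **Programs.** A literal is a ground atom $p$ or a default literal $\mathit{not}\,p$, with $\mathit{not}\,\mathit{not}\,p=p$; a rule $r$ has a head literal $H(r)$ and a finite set $B(r)$ of body literals; a program is a set of rules. A rule is positive if its head is an atom, and a fact if its body is empty. An interpretation $I$ is a *dynamic stable model* of a finite sequence of programs $\langle P_i\rangle_{i<n}$ if $I\cup\{\mathit{not}\,p: p\notin I\}$ is the least model (default literals being read as new atoms) of the program consisting of (i)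 every occurrence of a rule $r\in P_i$ for which there are no $j\ge i$ and $r'\in P_j$ with $H(r)=\mathit{not}\,H(r')$ and $I\models B(r')$, and (ii) the facts $\mathit{not}\,p$ for all atoms $p$ such that no rule $r\in\bigcup_i P_i$ has $H(r)=p$ and $I\models B(r)$. **Hybrid knowledge bases.** Fix a description logic, i.e. a set of axioms together with a translation $\kappa$ of each axiom $\phi$ to a first-order sentence $\kappa(\phi)$; $\mathsf{pr}(\phi)=\mathsf{pr}(\kappa(\phi))$ and $\kappa(O)=\{\kappa(\phi):\phi\in O\}$. A hybrid knowledge base is a pair $\langle O,P\rangle$ of a set of axioms and a program; a dynamic hybrid knowledge base is a finite sequence $\mathcal K=\langle\langle O_i,P_i\rangle\rangle_{i<n}$ of such pairs. $\mathcal K$ is *$O$-based* if all rules of all $P_i$ are positive facts, and *$P$-based* if all $O_i$ are empty. If $\mathcal K$ is $O$-based or $P$-based, an MKNF interpretation $M$ is a *basic dynamic MKNF model* of $\mathcal K$ if either $\mathcal K$ is $O$-based and $M$ is the minimal change update model of $\langle\kappa(O_i)\cup P_i\rangle_{i<n}$ (facts being read as ground atoms), or $\mathcal K$ is $P$-based and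 $M=\{J\in\mathcal I: I\subseteq J\}$ for some dynamic stable model $I$ of $\langle P_i\rangle_{i<n}$. A set $U\subseteq\mathbf P$ is a *splitting set* for $\mathcal K$ if for all $i$: every $\phi\in O_i$ with $\mathsf{pr}(\phi)\cap U\neq\emptyset$ has $\mathsf{pr}(\phi)\subseteq U$, and every $r\in P_i$ with $\mathsf{pr}(H(r))\cap U\ne\emptyset$ has $\mathsf{pr}(r)\subseteq U$. The bottom $b_U(\mathcal K)$ keeps in each component exactly the axioms and rules with all predicate symbols in $U$; the top $t_U(\mathcal K)$ keeps the remaining ones. For $X\subseteq\mathcal I$, the reduct $e_U(\mathcal K,X)$ has the ontologies of $t_U(\mathcal K)$ and, in each component, the rules obtained from those rules $r$ of $t_U(\mathcal K)$ such that, for the literals of $B(r)$ with predicate symbol in $U$, $X\models\mathbf K p$ for every such atom $p$ and $X\models\mathbf{not}\,p$ for every such default literal $\mathit{not}\,p$, by deleting from $B(r)$ all literals with predicate symbol in $U$. A *splitting sequence* for $\mathcal K$ is a nonempty sequence $\langle U_\alpha\rangle_{\alpha<\mu}$ of splitting sets, indexed by ordinals, that is monotone, continuous ($U_\alpha=\bigcup_{\eta<\alpha}U_\eta$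 for limit $\alpha$), and has union $\mathbf P$. $\mathcal K$ is *reducible relative to $U$* if either all its rules are positive with $\mathsf{pr}(B(r))\subseteq U$, or all its ontologies are empty. The splitting sequence is *update-enabling* if $b_{U_0}(\mathcal K)$ is reducible relative to $\emptyset$ and $t_{U_\alpha}(b_{U_{\alpha+1}}(\mathcal K))$ is reducible relative to $U_\alpha$ whenever $\alpha+1<\mu$. A *solution* to $\mathcal K$ with respect to it is a sequence $\langle X_\alpha\rangle_{\alpha<\mu}$ of MKNF interpretations such that $X_0$ is a basic dynamic MKNF model of $b_{U_0}(\mathcal K)$; $X_{\alpha+1}$ is a basic dynamic MKNF model of $e_{U_\alpha}(b_{U_{\alpha+1}}(\mathcal K),\bigcap_{\eta\le\alpha}X_\eta)$ whenever $\alpha+1<\mu$; and $X_\alpha=\mathcal I$ for limit $\alpha<\mu$. An MKNF interpretation $M$ is a *dynamic MKNF model* of $\mathcal K$ if $M=\bigcap_{\alpha<\mu}X_\alpha$ for some solution with respect to some update-enabling splitting sequence for $\mathcal K$. **Theorem.** Let $\mathcal K=\langle\langle O_i,P_i\rangle\rangle_{i<n}$ be a dynamic hybrid knowledge base such that $P_i$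 is empty for all $i<n$. Then $M$ is a dynamic MKNF model of $\mathcal K$ if and only if $M$ is the minimal change update model of $\langle\kappa(O_i)\rangle_{i<n}$. -/

import Mathlib

universe u v a w

namespace MKNF

/-! ### Signatures, MKNF formulae and Herbrand interpretations -/

/-- A function-free first-order signature: predicate symbols with arities, and infinitely many
constants. Under the standard names assumption the Herbrand universe is the set of constants. -/
structure Signature where
  Pred : Type u
  arity : Pred → ℕ
  Const : Type v
  infinite_const : Infinite Const

/-- Terms with free variables among `Fin n`. -/
inductive Term (σ : Signature.{u, v}) (n : ℕ) : Type v
  | var (x : Fin n)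
  | const (c : σ.Const)

/-- MKNF formulae with free variables among `Fin n`; in `ex φ` the quantified variable of `φ` is
the last one. -/
inductive Formula (σ : Signature.{u, v}) : ℕ → Type (max u v)
  | atom {n : ℕ} (P : σ.Pred) (t : Fin (σ.arity P) → Term σ n) : Formula σ n
  | neg {n : ℕ} (φ : Formula σ n) : Formula σ n
  | conj {n : ℕ} (φ ψ : Formula σ n) : Formula σ n
  | ex {n : ℕ} (φ : Formula σ (n + 1)) : Formula σ n
  | know {n : ℕ} (φ : Formula σ n) : Formula σ n
  | naf {n : ℕ} (φ : Formula σ n) : Formula σ n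

/-- MKNF sentences: formulae without free variables. -/
abbrev Sentence (σ : Signature.{u, v}) := Formula σ 0

/-- The set of predicate symbols occurring in a formula. -/
def Formula.preds {σ : Signature.{u, v}} : {n : ℕ} → Formula σ n → Set σ.Pred
  | _, .atom P _ => {P}
  | _, .neg φ => φ.preds
  | _, .conj φ ψ => φ.preds ∪ ψ.preds
  | _, .ex φ => φ.preds
  | _, .know φ => φ.preds
  | _, .naf φ => φ.preds

/-- A formula is first-order if no modal operator occurs in it. -/
def Formula.IsFirstOrder {σ : Signature.{u, v}} : {n : ℕ} → Formula σ n → Prop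
  | _, .atom _ _ => True
  | _, .neg φ => φ.IsFirstOrder
  | _, .conj φ ψ => φ.IsFirstOrder ∧ ψ.IsFirstOrder
  | _, .ex φ => φ.IsFirstOrder
  | _, .know _ => False
  | _, .naf _ => False

/-- First-order sentences. -/
abbrev FOSentence (σ : Signature.{u, v}) := {φ : Sentence σ // φ.IsFirstOrder}

/-- Ground atoms `P(c₁, …, cₖ)`. -/
@[ext]
structure GroundAtom (σ : Signature.{u, v}) where
  pred : σ.Pred
  args : Fin (σ.arity pred) → σ.Const

/-- A ground atom regarded as a sentence. -/
def GroundAtom.toSentence {σ : Signature.{u, v}} (p : GroundAtom σ) : Sentence σ :=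
  .atom p.pred fun i => .const (p.args i)

/-- A ground atom regarded as a first-order sentence. -/
def GroundAtom.toFO {σ : Signature.{u, v}} (p : GroundAtom σ) : FOSentence σ :=
  ⟨p.toSentence, trivial⟩

/-- A Herbrand interpretation: the set of ground atoms that are true. -/
abbrev Interp (σ : Signature.{u, v}) := Set (GroundAtom σ)

/-- The value of a term when the variables are replaced by the constants `e`. -/
def Term.eval {σ : Signature.{u, v}} {n : ℕ} (e : Fin n → σ.Const) : Term σ n → σ.Const
  | .var x => e x
  | .const c => c

/-- Satisfaction in the MKNF structure `⟨I, M, N⟩` of the sentence obtained from a formula by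
replacing its free variables by the constants `e`. -/
def Formula.Sat {σ : Signature.{u, v}} (M N : Set (Interp σ)) :
    {n : ℕ} → Formula σ n → Interp σ → (Fin n → σ.Const) → Prop
  | _, .atom P t, I, e => (⟨P, fun i => (t i).eval e⟩ : GroundAtom σ) ∈ I
  | _, .neg φ, I, e => ¬ φ.Sat M N I e
  | _, .conj φ ψ, I, e => φ.Sat M N I e ∧ ψ.Sat M N I e
  | _, .ex φ, I, e => ∃ c : σ.Const, φ.Sat M N I (Fin.snoc (α := fun _ => σ.Const) e c)
  | _, .know φ, _, e => ∀ J ∈ M, φ.Sat M N J e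
  | _, .naf φ, _, e => ∃ J ∈ N, ¬ φ.Sat M N J e

/-- `M ⊨ T`: every sentence of `T` holds in `⟨I, M, M⟩` for every `I ∈ M`. -/
def Models {σ : Signature.{u, v}} (M : Set (Interp σ)) (T : Set (Sentence σ)) : Prop :=
  ∀ φ ∈ T, ∀ I ∈ M, φ.Sat M M I Fin.elim0

/-- `mod(T)`, the greatest set `M` of interpretations with `M ⊨ T`. It is defined as the union of
all such sets, which is the greatest one if a greatest one exists; for first-order theories it
always exists, see `isGreatest_mod`. -/
def mod {σ : Signature.{u, v}} (T : Set (FOSentence σ)) : Set (Interp σ) :=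
  ⋃₀ {M | Models M (Subtype.val '' T)}

theorem Formula.IsFirstOrder.sat_iff {σ : Signature.{u, v}} (M N M' N' : Set (Interp σ)) :
    ∀ {n : ℕ} (φ : Formula σ n), φ.IsFirstOrder → ∀ (I : Interp σ) (e : Fin n → σ.Const),
      φ.Sat M N I e ↔ φ.Sat M' N' I e
  | _, .atom _ _, _, _, _ => Iff.rfl
  | _, .neg φ, h, I, e => not_congr (sat_iff M N M' N' φ h I e)
  | _, .conj φ ψ, h, I, e =>
      and_congr (sat_iff M N M' N' φ h.1 I e) (sat_iff M N M' N' ψ h.2 I e)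
  | _, .ex φ, h, I, _ => exists_congr fun _ => sat_iff M N M' N' φ h I _

theorem isGreatest_mod {σ : Signature.{u, v}} (T : Set (FOSentence σ)) :
    IsGreatest {M | Models M (Subtype.val '' T)} (mod T) := by
  refine ⟨?_, fun M hM => Set.subset_sUnion_of_mem hM⟩
  rintro _ ⟨φ, hφ, rfl⟩ I ⟨M, hM, hI⟩
  exact (Formula.IsFirstOrder.sat_iff M M _ _ φ.1 φ.2 I _).1 (hM _ ⟨φ, hφ, rfl⟩ I hI)

/-! ### The minimal change update semantics -/

/-- The atoms of `I` with predicate symbol `P`. -/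
def restrPred {σ : Signature.{u, v}} (P : σ.Pred) (I : Interp σ) : Set (GroundAtom σ) :=
  {p ∈ I | p.pred = P}

/-- The difference in the interpretation of `P` between `I` and `J`. -/
def diff {σ : Signature.{u, v}} (P : σ.Pred) (I J : Interp σ) : Set (GroundAtom σ) :=
  (restrPred P I \ restrPred P J) ∪ (restrPred P J \ restrPred P I)

/-- `J` is at least as close to `I` as `J'`. -/
def CloserEq {σ : Signature.{u, v}} (I J J' : Interp σ) : Prop :=
  ∀ P : σ.Pred, diff P I J ⊆ diff P I J'

/-- `J` is closer to `I` than `J'`. -/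
def Closer {σ : Signature.{u, v}} (I J J' : Interp σ) : Prop :=
  CloserEq I J J' ∧ ¬ CloserEq I J' J

/-- `I ⊕ N`. -/
def updateInterp {σ : Signature.{u, v}} (I : Interp σ) (N : Set (Interp σ)) : Set (Interp σ) :=
  {J ∈ N | ¬ ∃ J' ∈ N, Closer I J' J}

/-- `M ⊕ N`. -/
def update {σ : Signature.{u, v}} (M N : Set (Interp σ)) : Set (Interp σ) :=
  ⋃ I ∈ M, updateInterp I N

/-- `(⋯((M₀ ⊕ M₁) ⊕ M₂) ⊕ ⋯) ⊕ Mₙ₋₁`, started from the set of all interpretations `𝓘`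
(note `𝓘 ⊕ M₀ = M₀`), which is also the value for the empty sequence. -/
def updateSeq {σ : Signature.{u, v}} : (n : ℕ) → (Fin n → Set (Interp σ)) → Set (Interp σ)
  | 0, _ => Set.univ
  | n + 1, M => update (updateSeq n fun i => M i.castSucc) (M (Fin.last n))

/-- `M` is the minimal change update model of a finite sequence of first-order theories. -/
def IsMinimalChangeUpdateModel {σ : Signature.{u, v}} {n : ℕ} (T : Fin n → Set (FOSentence σ))
    (M : Set (Interp σ)) : Prop :=
  M.Nonempty ∧ M = updateSeq n fun i => mod (T i)

/-! ### Generalised logic programs and dynamic logic programs -/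

/-- Literals: ground atoms `p` and default literals `not p`. -/
inductive Literal (σ : Signature.{u, v}) : Type (max u v)
  | pos (p : GroundAtom σ)
  | naf (p : GroundAtom σ)

/-- Default negation of a literal; double default negation is absorbed. -/
def Literal.flip {σ : Signature.{u, v}} : Literal σ → Literal σ
  | .pos p => .naf p
  | .naf p => .pos p

def Literal.preds {σ : Signature.{u, v}} : Literal σ → Set σ.Pred
  | .pos p => {p.pred}
  | .naf p => {p.pred}

/-- The MKNF translation `π(p) = K p`, `π(not p) = not p` of a literal. -/
def Literal.toMKNF {σ : Signature.{u, v}} : Literal σ → Sentence σ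
  | .pos p => .know p.toSentence
  | .naf p => .naf p.toSentence

/-- Satisfaction of a literal in a Herbrand interpretation. -/
def Literal.Holds {σ : Signature.{u, v}} (I : Interp σ) : Literal σ → Prop
  | .pos p => p ∈ I
  | .naf p => p ∉ I

/-- Ground rules. -/
structure Rule (σ : Signature.{u, v}) where
  head : Literal σ
  body : Finset (Literal σ)

/-- The predicate symbols of the body of a rule. -/
def Rule.bodyPreds {σ : Signature.{u, v}} (r : Rule σ) : Set σ.Pred :=
  ⋃ L ∈ r.body, L.preds

def Rule.preds {σ : Signature.{u, v}} (r : Rule σ) : Set σ.Pred :=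
  r.head.preds ∪ r.bodyPreds

/-- A rule is positive if its head is an atom. -/
def Rule.IsPositive {σ : Signature.{u, v}} (r : Rule σ) : Prop :=
  ∃ p, r.head = .pos p

/-- A rule is a fact if its body is empty. -/
def Rule.IsFact {σ : Signature.{u, v}} (r : Rule σ) : Prop :=
  r.body = ∅

/-- `I ⊨ B(r)`. -/
def Rule.BodyHolds {σ : Signature.{u, v}} (I : Interp σ) (r : Rule σ) : Prop :=
  ∀ L ∈ r.body, L.Holds I

/-- Conflicting rules. -/
def Rule.Conflicts {σ : Signature.{u, v}} (r r' : Rule σ) : Prop :=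
  r.head = r'.head.flip

/-- A generalised logic program. -/
abbrev Program (σ : Signature.{u, v}) := Set (Rule σ)

/-- The least model of a program in which every default literal `not p` is read as a new atom, so
that the atoms of the resulting definite program are the literals. -/
def leastModel {σ : Signature.{u, v}} (R : Program σ) : Set (Literal σ) :=
  ⋂₀ {S | ∀ r ∈ R, (∀ L ∈ r.body, L ∈ S) → r.head ∈ S}

/-- The rules of a dynamic logic program with some occurrence that is not rejected: the occurrence
of `r` in the `i`-th program is rejected if a rule of the `j`-th program, `i ≤ j`, conflicts with
`r` and has a body that is true in `I`. -/
def unrejected {σ : Signature.{u, v}} {n : ℕ} (Q : Fin n → Program σ) (I : Interp σ) :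
    Program σ :=
  {r | ∃ i, r ∈ Q i ∧ ¬ ∃ j, i ≤ j ∧ ∃ r' ∈ Q j, r.Conflicts r' ∧ r'.BodyHolds I}

/-- The default assumptions `not p`, as facts. -/
def defaults {σ : Signature.{u, v}} {n : ℕ} (Q : Fin n → Program σ) (I : Interp σ) :
    Program σ :=
  {d | ∃ p : GroundAtom σ, d = ⟨.naf p, ∅⟩ ∧
    ¬ ∃ i, ∃ r ∈ Q i, r.head = .pos p ∧ r.BodyHolds I}

/-- Dynamic stable models of a dynamic logic program. -/
def IsDynamicStableModel {σ : Signature.{u, v}} {n : ℕ} (Q : Fin n → Program σ) (I : Interp σ) :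
    Prop :=
  {L : Literal σ | L.Holds I} = leastModel (unrejected Q I ∪ defaults Q I)

/-! ### Hybrid knowledge bases -/

/-- The description logic in use: its axioms, and the translation of axioms to function-free
first-order sentences. -/
structure DescriptionLogic (σ : Signature.{u, v}) where
  Ax : Type a
  toFO : Ax → FOSentence σ

/-- The predicate symbols of an axiom. -/
def DescriptionLogic.preds {σ : Signature.{u, v}} (D : DescriptionLogic.{u, v, a} σ) (φ : D.Ax) :
    Set σ.Pred :=
  (D.toFO φ).1.preds

/-- The first-order translation of an ontology. -/
def DescriptionLogic.theory {σ : Signature.{u, v}} (D : DescriptionLogic.{u, v, a} σ)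
    (O : Set D.Ax) : Set (FOSentence σ) :=
  D.toFO '' O

/-- A hybrid knowledge base `⟨O, P⟩`. -/
structure HybridKB {σ : Signature.{u, v}} (D : DescriptionLogic.{u, v, a} σ) where
  ont : Set D.Ax
  prog : Program σ

/-- The atoms `p` such that the positive fact `p` is in the program, as a first-order theory. -/
def factTheory {σ : Signature.{u, v}} (Q : Program σ) : Set (FOSentence σ) :=
  {φ | ∃ p : GroundAtom σ, (⟨.pos p, ∅⟩ : Rule σ) ∈ Q ∧ φ = p.toFO}

namespace HybridKB

variable {σ : Signature.{u, v}} {D : DescriptionLogic.{u, v, a} σ}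

def IsOntBased (K : HybridKB D) : Prop := ∀ r ∈ K.prog, r.IsPositive ∧ r.IsFact

def IsProgBased (K : HybridKB D) : Prop := K.ont = ∅

/-- `U` is a splitting set for `K`. -/
def IsSplittingSet (K : HybridKB D) (U : Set σ.Pred) : Prop :=
  (∀ φ ∈ K.ont, (D.preds φ ∩ U).Nonempty → D.preds φ ⊆ U) ∧
  (∀ r ∈ K.prog, (r.head.preds ∩ U).Nonempty → r.preds ⊆ U)

/-- The bottom `b_U(K)`. -/
def bottom (U : Set σ.Pred) (K : HybridKB D) : HybridKB D where
  ont := {φ ∈ K.ont | D.preds φ ⊆ U}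
  prog := {r ∈ K.prog | r.preds ⊆ U}

/-- The top `t_U(K)`. -/
def top (U : Set σ.Pred) (K : HybridKB D) : HybridKB D where
  ont := K.ont \ (K.bottom U).ont
  prog := K.prog \ (K.bottom U).prog

/-- The splitting set reduct `e_U(K, X)`. -/
def reduct (U : Set σ.Pred) (K : HybridKB D) (X : Set (Interp σ)) : HybridKB D where
  ont := (K.top U).ont
  prog := {r' | ∃ r ∈ (K.top U).prog,
    Models X (Literal.toMKNF '' {L | L ∈ r.body ∧ L.preds ⊆ U}) ∧
    r'.head = r.head ∧
    (r'.body : Set (Literal σ)) = {L | L ∈ r.body ∧ L.preds ⊆ Uᶜ}}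

def IsOntReducible (K : HybridKB D) (U : Set σ.Pred) : Prop :=
  ∀ r ∈ K.prog, r.IsPositive ∧ r.bodyPreds ⊆ U

def IsProgReducible (K : HybridKB D) : Prop := K.ont = ∅

end HybridKB

/-- A dynamic hybrid knowledge base of length `n`. -/
abbrev DynamicHybridKB {σ : Signature.{u, v}} (D : DescriptionLogic.{u, v, a} σ) (n : ℕ) :=
  Fin n → HybridKB D

namespace DynamicHybridKB

variable {σ : Signature.{u, v}} {D : DescriptionLogic.{u, v, a} σ} {n : ℕ}

/-- `M` is a dynamic MKNF model of a basic dynamic hybrid knowledge base. -/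
def IsBasicDynamicMKNFModel (K : DynamicHybridKB D n) (M : Set (Interp σ)) : Prop :=
  M.Nonempty ∧
  (((∀ i, (K i).IsOntBased) ∧
      IsMinimalChangeUpdateModel (fun i => D.theory (K i).ont ∪ factTheory (K i).prog) M) ∨
    ((∀ i, (K i).IsProgBased) ∧
      ∃ I : Interp σ, IsDynamicStableModel (fun i => (K i).prog) I ∧ M = {J | I ⊆ J}))

def bottom (U : Set σ.Pred) (K : DynamicHybridKB D n) : DynamicHybridKB D n :=
  fun i => (K i).bottom U

def top (U : Set σ.Pred) (K : DynamicHybridKB D n) : DynamicHybridKB D n :=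
  fun i => (K i).top U

def reduct (U : Set σ.Pred) (K : DynamicHybridKB D n) (X : Set (Interp σ)) :
    DynamicHybridKB D n :=
  fun i => (K i).reduct U X

/-- `U = ⟨U_α⟩_{α < μ}` is a splitting sequence for `K`: a nonempty, monotone, continuous sequence
of splitting sets that covers all predicate symbols. Only the values `U α` with `α < μ` matter. -/
structure IsSplittingSequence (K : DynamicHybridKB D n) (μ : Ordinal.{w})
    (U : Ordinal.{w} → Set σ.Pred) : Prop where
  pos : 0 < μ
  splitting : ∀ α < μ, ∀ i, (K i).IsSplittingSet (U α)
  mono : ∀ α β, α ≤ β → β < μ → U α ⊆ U β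
  continuous : ∀ α < μ, Order.IsSuccLimit α → U α = ⋃ η < α, U η
  cover : ⋃ α < μ, U α = Set.univ

/-- `K` is reducible relative to `U`. -/
def IsReducible (K : DynamicHybridKB D n) (U : Set σ.Pred) : Prop :=
  (∀ i, (K i).IsOntReducible U) ∨ (∀ i, (K i).IsProgReducible)

/-- `U` is an update-enabling splitting sequence for `K`. -/
structure IsUpdateEnabling (K : DynamicHybridKB D n) (μ : Ordinal.{w})
    (U : Ordinal.{w} → Set σ.Pred) : Prop extends K.IsSplittingSequence μ U where
  reducible_zero : (K.bottom (U 0)).IsReducible ∅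
  reducible_succ : ∀ α, α + 1 < μ → ((K.bottom (U (α + 1))).top (U α)).IsReducible (U α)

/-- `X = ⟨X_α⟩_{α < μ}` is a solution to `K` with respect to `U`. -/
structure IsSolution (K : DynamicHybridKB D n) (μ : Ordinal.{w}) (U : Ordinal.{w} → Set σ.Pred)
    (X : Ordinal.{w} → Set (Interp σ)) : Prop where
  nonempty : ∀ α < μ, (X α).Nonempty
  zero : (K.bottom (U 0)).IsBasicDynamicMKNFModel (X 0)
  succ : ∀ α, α + 1 < μ →
    ((K.bottom (U (α + 1))).reduct (U α) (⋂ η ≤ α, X η)).IsBasicDynamicMKNFModel (X (α + 1))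
  limit : ∀ α < μ, Order.IsSuccLimit α → X α = Set.univ

/-- `M` is a dynamic MKNF model of `K` with respect to `U`. -/
def IsDynamicMKNFModelWrt (K : DynamicHybridKB D n) (μ : Ordinal.{w})
    (U : Ordinal.{w} → Set σ.Pred) (M : Set (Interp σ)) : Prop :=
  M.Nonempty ∧ ∃ X : Ordinal.{w} → Set (Interp σ), K.IsSolution μ U X ∧ M = ⋂ α < μ, X α

/-- `M` is a dynamic MKNF model of the updatable dynamic hybrid knowledge base `K`: it is one with
respect to some update-enabling splitting sequence for `K`. -/
def IsDynamicMKNFModel (K : DynamicHybridKB D n) (M : Set (Interp σ)) : Prop :=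
  ∃ (μ : Ordinal.{w}) (U : Ordinal.{w} → Set σ.Pred),
    K.IsUpdateEnabling μ U ∧ K.IsDynamicMKNFModelWrt μ U M

end DynamicHybridKB

end MKNF

namespace MKNF

variable {σ : Signature.{u, v}}

/-! ### Models of first-order theories -/

/-! Give each predicate symbol a rank, the least index at which it enters the splitting sequence.
The splitting condition forces all symbols of an axiom to have the same rank, and every axiom has a
symbol, so the ontologies split into layers over pairwise disjoint vocabularies. Without rules, the
component `X α` of any solution is forced to be the minimal change update of layer `α` alone
(`solution_eq`): reducts alter only rules, so earlier components have no influence.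

It remains to see that intersecting the layerwise updates gives the update of the whole sequence.
Closeness is compared atom by atom (`closerEq_iff`), so updating decomposes along any partition of
the atoms, finite or not (`update_iInter`), and induction on the length extends this to sequences
(`updateSeq_iInter`). Hence every splitting sequence yields the same set. For the converse, the
one-term sequence consisting of all predicate symbols suffices. -/

theorem Formula.preds_nonempty : ∀ {n : ℕ} (φ : Formula σ n), φ.preds.Nonempty
  | _, .atom P _ => ⟨P, rfl⟩
  | _, .neg φ => preds_nonempty φ
  | _, .conj φ _ => (preds_nonempty φ).mono Set.subset_union_left
  | _, .ex φ => preds_nonempty φ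
  | _, .know φ => preds_nonempty φ
  | _, .naf φ => preds_nonempty φ

/-- Satisfaction of a first-order formula depends only on the atoms whose predicate symbol occurs
in the formula. -/
theorem Formula.IsFirstOrder.sat_congr (M N : Set (Interp σ)) {I J : Interp σ} :
    ∀ {n : ℕ} (φ : Formula σ n), φ.IsFirstOrder →
      (∀ p : GroundAtom σ, p.pred ∈ φ.preds → (p ∈ I ↔ p ∈ J)) → ∀ e : Fin n → σ.Const,
      φ.Sat M N I e ↔ φ.Sat M N J e
  | _, .atom _ _, _, h, _ => h _ rfl
  | _, .neg φ, hφ, h, e => not_congr (sat_congr M N φ hφ h e)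
  | _, .conj φ ψ, hφ, h, e =>
      and_congr (sat_congr M N φ hφ.1 (fun p hp => h p (Or.inl hp)) e)
        (sat_congr M N ψ hφ.2 (fun p hp => h p (Or.inr hp)) e)
  | _, .ex φ, hφ, h, _ => exists_congr fun _ => sat_congr M N φ hφ h _

/-- The modal components are irrelevant to first-order sentences; `∅` is an arbitrary choice. -/
theorem mem_mod {T : Set (FOSentence σ)} {I : Interp σ} :
    I ∈ mod T ↔ ∀ φ ∈ T, φ.1.Sat ∅ ∅ I Fin.elim0 := by
  constructor
  · rintro ⟨M, hM, hI⟩ φ hφ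
    exact (Formula.IsFirstOrder.sat_iff M M _ _ φ.1 φ.2 I _).1 (hM _ ⟨φ, hφ, rfl⟩ I hI)
  · refine fun h => ⟨{I}, ?_, rfl⟩
    rintro _ ⟨φ, hφ, rfl⟩ _ rfl
    exact (Formula.IsFirstOrder.sat_iff _ _ _ _ φ.1 φ.2 _ _).1 (h φ hφ)

theorem mod_empty : mod (∅ : Set (FOSentence σ)) = Set.univ := by
  ext I
  simp [mem_mod]

theorem mod_iUnion {ι : Sort*} (T : ι → Set (FOSentence σ)) :
    mod (⋃ i, T i) = ⋂ i, mod (T i) := by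
  ext I
  simp only [mem_mod, Set.mem_iUnion, Set.mem_iInter]
  exact ⟨fun h i φ hφ => h φ ⟨i, hφ⟩, fun h φ ⟨i, hφ⟩ => h i φ hφ⟩

/-! ### Updates of sets of interpretations that depend on disjoint sets of atoms -/

/-- Membership in `A` depends only on the truth values of the atoms in `V`. -/
def IsCylinder (V : Set (GroundAtom σ)) (A : Set (Interp σ)) : Prop :=
  ∀ ⦃I J : Interp σ⦄, (∀ p ∈ V, p ∈ I ↔ p ∈ J) → I ∈ A → J ∈ A

theorem isCylinder_mod {V : Set (GroundAtom σ)} {T : Set (FOSentence σ)}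
    (h : ∀ φ ∈ T, ∀ p : GroundAtom σ, p.pred ∈ φ.1.preds → p ∈ V) : IsCylinder V (mod T) :=
  fun _ _ hIJ hI => mem_mod.2 fun φ hφ =>
    (Formula.IsFirstOrder.sat_congr _ _ φ.1 φ.2 (fun p hp => hIJ p (h φ hφ p hp)) _).1
      (mem_mod.1 hI φ hφ)

/-- Every atom has exactly one predicate symbol, so the comparison symbol by symbol is a comparison
atom by atom, here in contrapositive form. -/
theorem closerEq_iff {I J J' : Interp σ} :
    CloserEq I J J' ↔ ∀ p, (p ∈ I ↔ p ∈ J') → (p ∈ I ↔ p ∈ J) := by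
  simp only [CloserEq, diff, restrPred, Set.subset_def, Set.mem_union, Set.mem_sdiff,
    Set.mem_ofPred_eq]
  constructor
  · intro h p hp
    have := h p.pred p
    tauto
  · intro h P p
    have := h p
    tauto

theorem closer_iff {I J J' : Interp σ} :
    Closer I J J' ↔ (∀ p, (p ∈ I ↔ p ∈ J') → (p ∈ I ↔ p ∈ J)) ∧
      ∃ p, (p ∈ I ↔ p ∈ J) ∧ ¬ (p ∈ I ↔ p ∈ J') := by
  simp only [Closer, closerEq_iff, not_forall, exists_prop]

theorem mem_update {A B : Set (Interp σ)} {J : Interp σ} :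
    J ∈ update A B ↔ ∃ I ∈ A, J ∈ B ∧ ∀ J' ∈ B, ¬ Closer I J' J := by
  simp only [update, updateInterp, Set.mem_iUnion, Set.mem_ofPred_eq, not_exists, not_and,
    exists_prop]

theorem mem_ite_of_mem {V I J : Set (GroundAtom σ)} {p : GroundAtom σ} (hp : p ∈ V) :
    p ∈ V.ite I J ↔ p ∈ I := by
  simp [Set.ite, hp]

theorem mem_ite_of_notMem {V I J : Set (GroundAtom σ)} {p : GroundAtom σ} (hp : p ∉ V) :
    p ∈ V.ite I J ↔ p ∈ J := by
  simp [Set.ite, hp]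

theorem IsCylinder.update {V : Set (GroundAtom σ)} {A B : Set (Interp σ)} (hA : IsCylinder V A)
    (hB : IsCylinder V B) : IsCylinder V (update A B) := by
  intro J J' hJ hJA
  obtain ⟨I, hI, hJB, hmin⟩ := mem_update.1 hJA
  -- The new starting point copies `I` on `V` and `J'` elsewhere. Off `V` it does not differ from
  -- `J'`, so a closer `L` improves strictly inside `V`, and transplanting that part of `L` into `J`
  -- would beat `J`.
  refine mem_update.2 ⟨V.ite I J', hA (fun p hp => (mem_ite_of_mem hp).symm) hI, hB hJ hJB, ?_⟩
  intro L hL hc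
  obtain ⟨hle, p, hp⟩ := closer_iff.1 hc
  refine hmin (V.ite L J) (hB (fun q hq => (mem_ite_of_mem hq).symm) hL)
    (closer_iff.2 ⟨fun q => ?_, p, ?_⟩)
  · by_cases hq : q ∈ V
    · have := hle q
      rw [mem_ite_of_mem hq] at this ⊢
      rwa [hJ q hq]
    · rw [mem_ite_of_notMem hq]
      exact id
  · by_cases hq : p ∈ V
    · rw [mem_ite_of_mem hq] at hp ⊢
      rwa [hJ p hq]
    · rw [mem_ite_of_notMem hq] at hp
      exact absurd Iff.rfl hp.2

theorem update_univ : update Set.univ (Set.univ : Set (Interp σ)) = Set.univ := by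
  refine Set.eq_univ_of_forall fun J => mem_update.2 ⟨J, trivial, trivial, fun J' _ h => ?_⟩
  obtain ⟨p, -, hp⟩ := (closer_iff.1 h).2
  exact hp Iff.rfl

/-- Updates can be computed separately on each class of a partition of the atoms. -/
theorem update_iInter {ι : Type*} (f : GroundAtom σ → ι) {A B : ι → Set (Interp σ)}
    (hA : ∀ i, IsCylinder (f ⁻¹' {i}) (A i)) (hB : ∀ i, IsCylinder (f ⁻¹' {i}) (B i)) :
    update (⋂ i, A i) (⋂ i, B i) = ⋂ i, update (A i) (B i) := by
  ext J
  simp only [Set.mem_iInter, mem_update]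
  constructor
  · rintro ⟨I, hI, hJ, hmin⟩ i
    -- Starting from `J` outside class `i` leaves nothing to change there. A closer `L` must then
    -- agree with `J` off the class, so it stays in every other `B j` and contradicts the global
    -- minimality of `J`.
    refine ⟨(f ⁻¹' {i}).ite I J, hA i (fun p hp => (mem_ite_of_mem hp).symm) (hI i), hJ i, ?_⟩
    intro L hL hc
    obtain ⟨hle, p, hp⟩ := closer_iff.1 hc
    have hoff : ∀ q, q ∉ f ⁻¹' {i} → (q ∈ J ↔ q ∈ L) := fun q hq => by
      have := hle q
      rw [mem_ite_of_notMem hq] at this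
      exact this Iff.rfl
    refine hmin L (fun j => ?_) (closer_iff.2 ⟨fun q => ?_, p, ?_⟩)
    · by_cases hj : j = i
      · exact hj ▸ hL
      · refine hB j (fun q hq => hoff q fun hq' => hj ?_) (hJ j)
        exact (Set.mem_singleton_iff.1 hq).symm.trans hq'
    · by_cases hq : q ∈ f ⁻¹' {i}
      · have := hle q
        rwa [mem_ite_of_mem hq] at this
      · rw [hoff q hq]
        exact id
    · by_cases hq : p ∈ f ⁻¹' {i}
      · rwa [mem_ite_of_mem hq] at hp
      · rw [mem_ite_of_notMem hq] at hp
        exact absurd Iff.rfl hp.2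
  · intro h
    choose I hI hJ hmin using h
    have hglue : ∀ i, ∀ p ∈ f ⁻¹' {i}, p ∈ I i ↔ p ∈ {q | q ∈ I (f q)} := by
      rintro _ p rfl
      exact Iff.rfl
    -- The starting points chosen for the classes are glued, each atom consulting the one for its
    -- own class. A globally closer `L` improves strictly at some `p`; only its part on the class of
    -- `p` is needed to contradict minimality there.
    refine ⟨{p | p ∈ I (f p)}, fun i => hA i (hglue i) (hI i), hJ, fun L hL hc => ?_⟩
    obtain ⟨hle, p, hp⟩ := closer_iff.1 hc
    refine hmin (f p) ((f ⁻¹' {f p}).ite L J)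
      (hB _ (fun q hq => (mem_ite_of_mem hq).symm) (hL _)) (closer_iff.2 ⟨fun q => ?_, p, ?_⟩)
    · by_cases hq : q ∈ f ⁻¹' {f p}
      · rw [mem_ite_of_mem hq, hglue _ q hq]
        exact hle q
      · rw [mem_ite_of_notMem hq]
        exact id
    · rw [mem_ite_of_mem (show p ∈ f ⁻¹' {f p} from rfl)]
      exact hp

theorem isCylinder_updateSeq {V : Set (GroundAtom σ)} :
    ∀ (n : ℕ) {M : Fin n → Set (Interp σ)}, (∀ k, IsCylinder V (M k)) →
      IsCylinder V (updateSeq n M)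
  | 0, _, _ => fun _ _ _ _ => trivial
  | n + 1, _, h => (isCylinder_updateSeq n fun k => h k.castSucc).update (h (Fin.last n))

theorem updateSeq_univ : ∀ n : ℕ, updateSeq n (fun _ => (Set.univ : Set (Interp σ))) = Set.univ
  | 0 => rfl
  | n + 1 => by rw [updateSeq, updateSeq_univ n, update_univ]

/-- Induction on the length: partial updates remain cylinders over their class, so `update_iInter`
applies again at each step. -/
theorem updateSeq_iInter {ι : Type*} (f : GroundAtom σ → ι) :
    ∀ (n : ℕ) {M : ι → Fin n → Set (Interp σ)}, (∀ i k, IsCylinder (f ⁻¹' {i}) (M i k)) →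
      updateSeq n (fun k => ⋂ i, M i k) = ⋂ i, updateSeq n (M i)
  | 0, _, _ => by simp [updateSeq]
  | n + 1, M, h => by
    simp only [updateSeq]
    rw [updateSeq_iInter f n fun i k => h i k.castSucc,
      update_iInter f (fun i => isCylinder_updateSeq n fun k => h i k.castSucc)
        fun i => h i (Fin.last n)]

/-! ### Knowledge bases without rules -/

theorem factTheory_empty : factTheory (∅ : Program σ) = ∅ := by
  simp [factTheory]

/-- A dynamic logic program without rules has no dynamic stable model but `∅`. -/
theorem IsDynamicStableModel.eq_empty {n : ℕ} {Q : Fin n → Program σ} {I : Interp σ}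
    (hQ : ∀ i, Q i = ∅) (h : IsDynamicStableModel Q I) : I = ∅ := by
  refine Set.eq_empty_of_forall_notMem fun p hp => ?_
  have hmem : Literal.pos p ∈ leastModel (unrejected Q I ∪ defaults Q I) :=
    h ▸ (show Literal.pos p ∈ {L : Literal σ | L.Holds I} from hp)
  -- The default literals are closed under the program, since its only rules are the default
  -- assumptions; so the least model contains no atom.
  obtain ⟨q, hq⟩ := hmem (Set.range Literal.naf) <| by
    rintro r (⟨i, hr, -⟩ | ⟨q, rfl, -⟩) -
    · simp [hQ] at hr
    · exact ⟨q, rfl⟩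
  cases hq

namespace DynamicHybridKB

variable {D : DescriptionLogic.{u, v, a} σ} {n : ℕ}

/-- The two readings of a basic knowledge base agree here: in the program-based case there are
neither axioms nor rules, and both sides are the set of all interpretations. -/
theorem IsBasicDynamicMKNFModel.eq_updateSeq {K : DynamicHybridKB D n} {M : Set (Interp σ)}
    (hK : ∀ i, (K i).prog = ∅) (h : K.IsBasicDynamicMKNFModel M) :
    M = updateSeq n fun i => mod (D.theory (K i).ont) := by
  rcases h.2 with ⟨-, -, h⟩ | ⟨hO, I, hI, rfl⟩
  · simpa only [hK, factTheory_empty, Set.union_empty] using h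
  · have hO' : ∀ i, (K i).ont = ∅ := hO
    simp only [hO', DescriptionLogic.theory, Set.image_empty, mod_empty, updateSeq_univ,
      hI.eq_empty hK, Set.empty_subset, Set.ofPred_true]

theorem isBasicDynamicMKNFModel_of_prog_eq_empty {K : DynamicHybridKB D n} {M : Set (Interp σ)}
    (hK : ∀ i, (K i).prog = ∅)
    (h : IsMinimalChangeUpdateModel (fun i => D.theory (K i).ont) M) :
    K.IsBasicDynamicMKNFModel M := by
  refine ⟨h.1, Or.inl ⟨fun i r hr => ?_, ?_⟩⟩
  · simp [hK] at hr
  · simpa only [hK, factTheory_empty, Set.union_empty] using h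

theorem bottom_univ (K : DynamicHybridKB D n) : K.bottom Set.univ = K := by
  funext i
  simp [bottom, HybridKB.bottom]

/-- The axioms of the `i`-th ontology all of whose predicate symbols first occur in `U` at `α`. -/
def layerOnt (K : DynamicHybridKB D n) (U : Ordinal.{w} → Set σ.Pred) (α : Ordinal.{w})
    (i : Fin n) : Set D.Ax :=
  {φ ∈ (K i).ont | ∀ P ∈ D.preds φ, sInf {β | P ∈ U β} = α}

/-! ### Ranks of predicate symbols and layers of axioms -/

namespace IsSplittingSequence

variable {K : DynamicHybridKB D n} {μ : Ordinal.{w}} {U : Ordinal.{w} → Set σ.Pred}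

theorem exists_mem (h : K.IsSplittingSequence μ U) (P : σ.Pred) : ∃ α < μ, P ∈ U α := by
  have hP : P ∈ ⋃ α < μ, U α := h.cover ▸ Set.mem_univ P
  simpa only [Set.mem_iUnion, exists_prop] using hP

/-- Covering is essential: the infimum of the empty set is `0`, a spurious rank for a symbol that
never enters. -/
theorem mem_sInf (h : K.IsSplittingSequence μ U) (P : σ.Pred) : P ∈ U (sInf {β | P ∈ U β}) :=
  have ⟨α, _, hα⟩ := h.exists_mem P
  csInf_mem (s := {β | P ∈ U β}) ⟨α, hα⟩

theorem sInf_lt (h : K.IsSplittingSequence μ U) (P : σ.Pred) : sInf {β | P ∈ U β} < μ :=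
  have ⟨_, hα, hP⟩ := h.exists_mem P
  (csInf_le' (s := {β | P ∈ U β}) hP).trans_lt hα

theorem mem_iff (h : K.IsSplittingSequence μ U) (P : σ.Pred) {α : Ordinal.{w}} (hα : α < μ) :
    P ∈ U α ↔ sInf {β | P ∈ U β} ≤ α :=
  ⟨fun hP => csInf_le' hP, fun hle => h.mono _ _ hle hα (h.mem_sInf P)⟩

/-- No predicate symbol occurs in a splitting sequence for the first time at a limit ordinal. -/
theorem sInf_ne_limit (h : K.IsSplittingSequence μ U) (P : σ.Pred) {α : Ordinal.{w}} (hα : α < μ)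
    (hlim : Order.IsSuccLimit α) : sInf {β | P ∈ U β} ≠ α := by
  rintro rfl
  have hP := h.mem_sInf P
  rw [h.continuous _ hα hlim] at hP
  simp only [Set.mem_iUnion, exists_prop] at hP
  obtain ⟨η, hη, hPη⟩ := hP
  exact hη.not_ge (csInf_le' hPη)

/-- All predicate symbols of an axiom occur in a splitting sequence for the first time at the same
ordinal. -/
theorem sInf_eq_sInf (h : K.IsSplittingSequence μ U) {i : Fin n} {φ : D.Ax} (hφ : φ ∈ (K i).ont)
    {P Q : σ.Pred} (hP : P ∈ D.preds φ) (hQ : Q ∈ D.preds φ) :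
    sInf {β | P ∈ U β} = sInf {β | Q ∈ U β} := by
  have key : ∀ {P Q : σ.Pred}, P ∈ D.preds φ → Q ∈ D.preds φ →
      sInf {β | P ∈ U β} ≤ sInf {β | Q ∈ U β} := fun {P Q} hP hQ =>
    -- At the rank of `Q` the axiom meets the splitting set, hence lies inside it.
    csInf_le' ((h.splitting _ (h.sInf_lt Q) i).1 φ hφ ⟨Q, hQ, h.mem_sInf Q⟩ hP)
  exact le_antisymm (key hP hQ) (key hQ hP)

theorem iUnion_layerOnt (h : K.IsSplittingSequence μ U) (i : Fin n) :
    ⋃ α, K.layerOnt U α i = (K i).ont := by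
  refine Set.Subset.antisymm (Set.iUnion_subset fun α => Set.sep_subset _ _) fun φ hφ => ?_
  obtain ⟨P, hP⟩ := (D.toFO φ).1.preds_nonempty
  exact Set.mem_iUnion.2 ⟨_, hφ, fun Q hQ => h.sInf_eq_sInf hφ hQ hP⟩

theorem bottom_zero_ont (h : K.IsSplittingSequence μ U) (i : Fin n) :
    (K.bottom (U 0) i).ont = K.layerOnt U 0 i := by
  ext φ
  refine and_congr_right fun _ => forall_congr' fun P => imp_congr_right fun _ => ?_
  rw [h.mem_iff P h.pos, nonpos_iff_eq_zero]

/-- An axiom not contained in the splitting set `U α` is disjoint from it, so being new at `α + 1`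
means that all its symbols have rank exactly `α + 1`. -/
theorem reduct_succ_ont (h : K.IsSplittingSequence μ U) {α : Ordinal.{w}} (hα : α + 1 < μ)
    (X : Set (Interp σ)) (i : Fin n) :
    ((K.bottom (U (α + 1))).reduct (U α) X i).ont = K.layerOnt U (α + 1) i := by
  have hlt : α < μ := (Order.lt_add_one_iff.2 le_rfl).trans hα
  ext φ
  simp only [reduct, HybridKB.reduct, HybridKB.top, bottom, HybridKB.bottom, layerOnt,
    Set.mem_sdiff, Set.mem_ofPred_eq]
  constructor
  · rintro ⟨⟨hφ, hsub⟩, hnot⟩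
    refine ⟨hφ, fun P hP => le_antisymm ((h.mem_iff P hα).1 (hsub hP)) ?_⟩
    rw [Order.add_one_le_iff, ← not_le, ← h.mem_iff P hlt]
    exact fun hPα => hnot ⟨⟨hφ, hsub⟩, (h.splitting α hlt i).1 φ hφ ⟨P, hP, hPα⟩⟩
  · rintro ⟨hφ, heq⟩
    refine ⟨⟨hφ, fun P hP => (h.mem_iff P hα).2 (heq P hP).le⟩, fun hsub => ?_⟩
    obtain ⟨P, hP⟩ := (D.toFO φ).1.preds_nonempty
    have := (h.mem_iff P hlt).1 (hsub.2 hP)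
    rw [heq P hP] at this
    exact this.not_gt (Order.lt_add_one_iff.2 le_rfl)

theorem layerOnt_eq_empty {α : Ordinal.{w}} (hα : ∀ P, sInf {β | P ∈ U β} ≠ α) (i : Fin n) :
    K.layerOnt U α i = ∅ := by
  refine Set.eq_empty_of_forall_notMem fun φ hφ => ?_
  obtain ⟨P, hP⟩ := (D.toFO φ).1.preds_nonempty
  exact hα P (hφ.2 P hP)

theorem updateSeq_layerOnt_eq_univ {α : Ordinal.{w}} (hα : ∀ P, sInf {β | P ∈ U β} ≠ α) :
    (updateSeq n fun i => mod (D.theory (K.layerOnt U α i))) = Set.univ := by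
  simp only [layerOnt_eq_empty hα, DescriptionLogic.theory, Set.image_empty, mod_empty,
    updateSeq_univ]

/-- The minimal change update semantics of the ontologies can be computed layer by layer. -/
theorem updateSeq_eq_iInter (h : K.IsSplittingSequence μ U) :
    (updateSeq n fun i => mod (D.theory (K i).ont)) =
      ⋂ α, updateSeq n fun i => mod (D.theory (K.layerOnt U α i)) := by
  -- The atoms are partitioned by the rank of their predicate symbol.
  rw [← updateSeq_iInter (fun p : GroundAtom σ => sInf {β | p.pred ∈ U β})]
  · congr 1
    funext i
    rw [← mod_iUnion, ← h.iUnion_layerOnt i, DescriptionLogic.theory, Set.image_iUnion]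
    rfl
  · intro α i
    refine isCylinder_mod ?_
    rintro _ ⟨φ, hφ, rfl⟩ p hp
    exact hφ.2 p.pred hp

/-- A case distinction without induction suffices, as no component depends on earlier ones. At
limits the prescribed value is right because no symbol has limit rank, so the layer is empty. -/
theorem solution_eq (h : K.IsSplittingSequence μ U) (hK : ∀ i, (K i).prog = ∅)
    {X : Ordinal.{w} → Set (Interp σ)} (hX : K.IsSolution μ U X) {α : Ordinal.{w}} (hα : α < μ) :
    X α = updateSeq n fun i => mod (D.theory (K.layerOnt U α i)) := by
  rcases Ordinal.zero_or_succ_or_isSuccLimit α with rfl | ⟨β, rfl⟩ | hlim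
  · rw [hX.zero.eq_updateSeq fun i => by simp [bottom, HybridKB.bottom, hK]]
    simp only [h.bottom_zero_ont]
  · rw [Order.succ_eq_add_one] at hα ⊢
    rw [(hX.succ β hα).eq_updateSeq fun i => by
      simp [reduct, HybridKB.reduct, HybridKB.top, bottom, HybridKB.bottom, hK]]
    simp only [h.reduct_succ_ont hα]
  · rw [hX.limit α hα hlim, updateSeq_layerOnt_eq_univ fun P => h.sInf_ne_limit P hα hlim]

theorem iInter_solution (h : K.IsSplittingSequence μ U) (hK : ∀ i, (K i).prog = ∅)
    {X : Ordinal.{w} → Set (Interp σ)} (hX : K.IsSolution μ U X) :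
    ⋂ α < μ, X α = updateSeq n fun i => mod (D.theory (K i).ont) := by
  rw [h.updateSeq_eq_iInter]
  refine Set.iInter_congr fun α => ?_
  by_cases hα : α < μ
  · simp only [hα, Set.iInter_true, h.solution_eq hK hX hα]
  -- Ranks lie below `μ`, so the layers from `μ` on are empty and contribute nothing to the
  -- intersection.
  · rw [updateSeq_layerOnt_eq_univ fun P (hP : sInf {β | P ∈ U β} = α) =>
      hα (hP ▸ h.sInf_lt P)]
    simp [hα]

end IsSplittingSequence

/-! ### The one-term splitting sequence -/

theorem isUpdateEnabling_univ (K : DynamicHybridKB D n) (hK : ∀ i, (K i).prog = ∅) :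
    K.IsUpdateEnabling (1 : Ordinal.{w}) fun _ => Set.univ where
  pos := zero_lt_one
  splitting _ _ _ := ⟨fun _ _ _ => Set.subset_univ _, fun _ _ _ => Set.subset_univ _⟩
  mono _ _ _ _ := Set.Subset.rfl
  continuous α hα hlim := absurd (Order.lt_one_iff.1 hα) hlim.ne_bot
  cover := Set.eq_univ_of_forall fun P =>
    Set.mem_iUnion₂.2 ⟨0, zero_lt_one, Set.mem_univ P⟩
  reducible_zero := Or.inl fun i r hr => by simp [bottom_univ, hK] at hr
  reducible_succ α hα := by simp at hα

theorem isSolution_univ {K : DynamicHybridKB D n} {M : Set (Interp σ)}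
    (hM : K.IsBasicDynamicMKNFModel M) :
    K.IsSolution (1 : Ordinal.{w}) (fun _ => Set.univ) fun _ => M where
  nonempty _ _ := hM.1
  zero := by rwa [bottom_univ]
  succ α hα := by simp at hα
  limit α hα hlim := absurd (Order.lt_one_iff.1 hα) hlim.ne_bot

end DynamicHybridKB

end MKNF

theorem mainTheorem5 {σ : MKNF.Signature.{u, v}} (D : MKNF.DescriptionLogic.{u, v, a} σ) {n : ℕ}
    (K : MKNF.DynamicHybridKB D n) (hK : ∀ i, (K i).prog = ∅) (M : Set (MKNF.Interp σ)) :
    MKNF.DynamicHybridKB.IsDynamicMKNFModel.{u, v, a, w} K M ↔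
      MKNF.IsMinimalChangeUpdateModel (fun i => D.theory (K i).ont) M := by
  constructor
  · rintro ⟨μ, U, hU, hne, X, hX, rfl⟩
    exact ⟨hne, hU.toIsSplittingSequence.iInter_solution hK hX⟩
  · intro hM
    refine ⟨1, fun _ => Set.univ, K.isUpdateEnabling_univ hK, hM.1, fun _ => M,
      MKNF.DynamicHybridKB.isSolution_univ
        (MKNF.DynamicHybridKB.isBasicDynamicMKNFModel_of_prog_eq_empty hK hM), ?_⟩
    exact (Set.biInter_const (s := Set.Iio (1 : Ordinal.{w})) ⟨0, Set.mem_Iio.2 zero_lt_one⟩ M).symm
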